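/- **Setting.** Let $M$ be a (Hausdorff, $\sigma$-compact, finite-dimensional) smooth manifold, $V\to M$ a smooth real vector bundle of finite rank, $\nabla$ a smooth torsion-free connection on $T_M$ (for instance a Levi-Civita connection), and $\nabla'$ a smooth connection on $V$. Let $$C=\Omega_M\otimes\Gamma\big(\widehat{\mathrm{Sym}}(T_M^\vee)\otimes\Lambda(V^\vee)\big),$$ graded by form degree plus degree in $\Lambda(V^\vee)$. Locally it is generated over smooth functions by $dx^i$, $y^i$, $v^a$ of degrees $1,0,1$, where $(y^i)$, $(v^a)$ are the frames dual to the frames $(y_i)$ of $T_M$ (coordinate fields) and $(v_a)$ of $V$. All operators below are derivations of $C$ of degree one, and $[\cdot,\cdot]$ is their graded commutator. Let $D=\sum_{n\ge0}D_n$, where $D_0=\delta=dx^i\,\partial/\partial y^i$, where $D_1$ is the de Rham differential on $\Omega_M$ and the dual connection of $\nabla$, $\nabla'$ on $y^i$, $v^a$, and where for $n\ge2$ $$D_n=\tfrac1{n!}(l_n)^i_{i_1\cdots i_n}y^{i_1}\cdots y^{i_n}\frac{\partial}{\partial y^i}+\tfrac1{(n-1)!}(l'_n)^b_{i_1\cdots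 i_{n-1},a}y^{i_1}\cdots y^{i_{n-1}}v^a\frac{\partial}{\partial v^b}$$ for bundle maps $l_n:\mathrm{Sym}^nT_M\to T_M^\vee\otimes T_M$ and $l'_n:\mathrm{Sym}^{n-1}T_M\otimes V\to T_M^\vee\otimes V$. Here $(l_n)^i_{i_1\cdots i_n}$ is the $y_i$-component of $l_n(y_{i_1},\dots,y_{i_n})$, a one-form, and similarly for all other brackets. Assume - $D^2=0$, and - the $\delta^{-1}$ gauge: $\delta^{-1}(D_n(y^i))=0$ and $\delta^{-1}(D_n(v^a))=0$ for all $n\ge2$, where $\delta^{-1}=\frac1{p+q}\,y^i\iota_{\partial/\partial x^i}$ on $\Omega^p_M\otimes\Gamma(\mathrm{Sym}^q(T_M^\vee)\otimes\Lambda(V^\vee))$, $p+q>0$. Let $\rho_{1+m}:V\otimes\mathrm{Sym}^mT_M\to T_M$ and $\mu_{2+m}:\Lambda^2V\otimes\mathrm{Sym}^mT_M\to V$, $m\ge0$, be bundle maps, with arbitrary initial data $\rho=\rho_{1+0}$ and $\mu=\mu_{2+0}$. Put $$d^\rho=-\rho^i_a\,v^a\frac{\partial}{\partial y^i}+\sum_{m\ge1}\tfrac1{m!}(\rho_{1+m})^i_{i_1\cdots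 i_m,a}\,y^{i_1}\cdots y^{i_m}v^a\frac{\partial}{\partial y^i},\qquad d^\mu=\sum_{m\ge0}\tfrac1{m!\,2!}(\mu_{2+m})^c_{i_1\cdots i_m,a,b}\,y^{i_1}\cdots y^{i_m}v^a\wedge v^b\frac{\partial}{\partial v^c},$$ where the unary bracket $\rho$ enters with a minus sign because it is dualized as part of the superconnection $\nabla+\nabla'+\rho$ on $T_M\oplus V[1]$. Assume $$[D,\;d^\rho+d^\mu]=0.$$ **Proposition (lower brackets in the $\delta^{-1}$ gauge).** For all $X\in\Gamma(T_M)$ and $\alpha,\beta\in\Gamma(V)$, $$\rho_{1+1}(X,\alpha)=\nabla_X\rho(\alpha)-\rho(\nabla'_X\alpha),$$ $$\mu_{2+1}(X,\alpha,\beta)=-\big(\nabla'^{(1)}_X\mu\big)(\alpha,\beta)+\tfrac12R_{\nabla'}(X,\rho(\alpha))\beta-\tfrac12R_{\nabla'}(X,\rho(\beta))\alpha,$$ where $(\nabla'^{(1)}_X\mu)(\alpha,\beta)=\nabla'_X\mu(\alpha,\beta)-\mu(\nabla'_X\alpha,\beta)-\mu(\alpha,\nabla'_X\beta)$ and $R_{\nabla'}(X,Y)=\nabla'_X\nabla'_Y-\nabla'_Y\nabla'_X-\nabla'_{[X,Y]}$.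 -/

import Mathlib

open scoped Manifold ContDiff TensorProduct

noncomputable section

/-! ### The Chevalley--Eilenberg algebra and its elementary operators

Here `A` stands for the smooth functions on `M`, `P` for the vector fields and `E` for the sections
of `V`. -/

section Cochains

variable (A P E : Type*) [CommRing A] [AddCommGroup P] [Module A P] [AddCommGroup E] [Module A E]

/-- The exterior factor: it is generated over `A` by the differential forms `θ : P → A` and by the
linear forms `ξ : E → A`, both of which have degree one (the fibre of `V` is shifted). -/
abbrev ExtPart : Type _ := ExteriorAlgebra A (Module.Dual A P × Module.Dual A E)

/-- The graded symmetric algebra over `Ω_M` of `T_M^∨ ⊕ V^∨[-1]`, that is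
`Ω_M ⊗ Sym (T_M^∨) ⊗ Λ (V^∨)`. The generators of the symmetric factor have degree zero.
The formal completion in the symmetric variables is accounted for by working with the homogeneous
components of operators. -/
abbrev Cochain : Type _ := ExtPart A P E ⊗[A] SymmetricAlgebra A (Module.Dual A P)

variable {A P E}

namespace Cochain

/-- A form `θ` as an element of `Ω^1_M` (locally, the generators `dx^i`). -/
def formGen : Module.Dual A P →ₗ[A] Cochain A P E :=
  (TensorProduct.mk A (ExtPart A P E) (SymmetricAlgebra A (Module.Dual A P))).flip 1 ∘ₗ
    ExteriorAlgebra.ι A ∘ₗ LinearMap.inl A (Module.Dual A P) (Module.Dual A E)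

/-- A linear form on `V` as a generator of degree one (locally, the generators `v^a`). -/
def fibGen : Module.Dual A E →ₗ[A] Cochain A P E :=
  (TensorProduct.mk A (ExtPart A P E) (SymmetricAlgebra A (Module.Dual A P))).flip 1 ∘ₗ
    ExteriorAlgebra.ι A ∘ₗ LinearMap.inr A (Module.Dual A P) (Module.Dual A E)

/-- A linear form on `T_M` as a generator of degree zero (locally, the generators `y^i`). -/
def symGen : Module.Dual A P →ₗ[A] Cochain A P E :=
  TensorProduct.mk A (ExtPart A P E) (SymmetricAlgebra A (Module.Dual A P)) 1 ∘ₗ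
    SymmetricAlgebra.ι A (Module.Dual A P)

/-- The part `Ω^p ⊗ Sym^q (T_M^∨) ⊗ Λ^r (V^∨)`. -/
def comp (p q r : ℕ) : Submodule A (Cochain A P E) :=
  LinearMap.range (formGen (A := A) (P := P) (E := E)) ^ p *
    LinearMap.range (symGen (A := A) (P := P) (E := E)) ^ q *
    LinearMap.range (fibGen (A := A) (P := P) (E := E)) ^ r

/-- The parity automorphism, equal to `(-1)^k` in degree `k`. -/
def parity : Cochain A P E →ₐ[A] Cochain A P E :=
  Algebra.TensorProduct.map CliffordAlgebra.involute
    (AlgHom.id A (SymmetricAlgebra A (Module.Dual A P)))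

/-- `d` obeys the Leibniz rule of a derivation of odd degree. -/
def IsOddDerivation (d : Cochain A P E →+ Cochain A P E) : Prop :=
  ∀ a b, d (a * b) = d a * b + parity a * d b

/-- Contraction of the form part with a vector field (locally `X^i ι_{∂/∂x^i}`). -/
def formContract (X : P) : Cochain A P E →ₗ[A] Cochain A P E :=
  LinearMap.rTensor _ (CliffordAlgebra.contractLeft (Q := 0)
    (Module.Dual.eval A P X ∘ₗ LinearMap.fst A (Module.Dual A P) (Module.Dual A E)))

/-- Contraction with a section of `V` (locally `α^a ∂/∂v^a`). -/
def fibContract (α : E) : Cochain A P E →ₗ[A] Cochain A P E :=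
  LinearMap.rTensor _ (CliffordAlgebra.contractLeft (Q := 0)
    (Module.Dual.eval A E α ∘ₗ LinearMap.snd A (Module.Dual A P) (Module.Dual A E)))

/-- The algebra map `s ↦ s + ε ∂_Y s` to the dual numbers, where `∂_Y η = η Y` on generators. -/
def symTaylor (Y : P) : SymmetricAlgebra A (Module.Dual A P) →ₐ[A]
    TrivSqZeroExt (SymmetricAlgebra A (Module.Dual A P))
      (SymmetricAlgebra A (Module.Dual A P)) :=
  SymmetricAlgebra.lift
    { toFun := fun η => TrivSqZeroExt.inl (SymmetricAlgebra.ι A _ η) +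
        TrivSqZeroExt.inr (algebraMap A _ (η Y))
      map_add' := fun η θ => by
        simp only [map_add, LinearMap.add_apply, TrivSqZeroExt.inl_add, TrivSqZeroExt.inr_add]
        abel
      map_smul' := fun a η => by
        have h : algebraMap A (SymmetricAlgebra A (Module.Dual A P)) (a * η Y) =
            a • algebraMap A (SymmetricAlgebra A (Module.Dual A P)) (η Y) := by
          rw [map_mul, Algebra.smul_def]
        simp only [map_smul, LinearMap.smul_apply, smul_eq_mul, h, TrivSqZeroExt.inl_smul,
          TrivSqZeroExt.inr_smul, smul_add, RingHom.id_apply] }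

/-- The derivation `∂_Y` of the symmetric algebra (locally `Y^i ∂/∂y^i`). -/
def symDeriv (Y : P) :
    SymmetricAlgebra A (Module.Dual A P) →ₗ[A] SymmetricAlgebra A (Module.Dual A P) where
  toFun s := (symTaylor Y s).snd
  map_add' s t := by simp
  map_smul' a s := by simp

/-- `∂_Y` on cochains. -/
def symContract (Y : P) : Cochain A P E →ₗ[A] Cochain A P E :=
  LinearMap.lTensor _ (symDeriv Y)

/-- The composition `∂_{Y_1} ⋯ ∂_{Y_m}`. -/
def symContractAll {m : ℕ} (Y : Fin m → P) : Cochain A P E →ₗ[A] Cochain A P E :=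
  (List.ofFn fun i => (symContract (Y i) : Module.End A (Cochain A P E))).prod

/-- One step of the recursion `(w, (x, z)) ↦ w_sym x - w z` defining `y^i ι_{∂/∂x^i}`: the form part
of the generator `w` is moved to the symmetric factor. -/
def formToSymStep : (Module.Dual A P × Module.Dual A E) →ₗ[A]
    (ExtPart A P E × Cochain A P E) →ₗ[A] Cochain A P E :=
  LinearMap.mk₂ A
    (fun w z => z.1 ⊗ₜ SymmetricAlgebra.ι A _ w.1 - (ExteriorAlgebra.ι A w ⊗ₜ 1) * z.2)
    (fun w w' z => by simp only [Prod.fst_add, map_add, TensorProduct.tmul_add,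
      TensorProduct.add_tmul, add_mul]; abel)
    (fun a w z => by simp only [Prod.smul_fst, map_smul, TensorProduct.tmul_smul,
      ← TensorProduct.smul_tmul', smul_mul_assoc, smul_sub])
    (fun w z z' => by simp only [Prod.fst_add, Prod.snd_add, TensorProduct.add_tmul, mul_add]; abel)
    (fun a w z => by simp only [Prod.smul_fst, Prod.smul_snd, ← TensorProduct.smul_tmul',
      mul_smul_comm, smul_sub])

/-- The restriction of `y^i ι_{∂/∂x^i}` to the exterior factor. -/
def formToSymExt : ExtPart A P E →ₗ[A] Cochain A P E :=
  CliffordAlgebra.foldr' 0 formToSymStep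
    (fun w x z => by
      have h : (ExteriorAlgebra.ι A w ⊗ₜ[A] (1 : SymmetricAlgebra A (Module.Dual A P))) *
          (ExteriorAlgebra.ι A w ⊗ₜ[A] 1) = 0 := by
        rw [Algebra.TensorProduct.tmul_mul_tmul, ExteriorAlgebra.ι_sq_zero, TensorProduct.zero_tmul]
      simp only [formToSymStep, LinearMap.mk₂_apply, mul_sub, ← mul_assoc, h]
      simp [Algebra.TensorProduct.tmul_mul_tmul, ExteriorAlgebra.ι])
    0

/-- The operator `y^i ι_{∂/∂x^i}`. -/
def formToSym : Cochain A P E →ₗ[A] Cochain A P E :=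
  TensorProduct.lift (LinearMap.mk₂ A (fun x s => formToSymExt x * (1 ⊗ₜ s))
    (fun x x' s => by simp [add_mul]) (fun a x s => by
      rw [map_smul]; exact Algebra.smul_mul_assoc a _ _)
    (fun x s s' => by simp [TensorProduct.tmul_add, mul_add]) (fun a x s => by
      rw [TensorProduct.tmul_smul]; exact Algebra.mul_smul_comm a _ _))

/-- The homotopy contraction `δ⁻¹ = (p + q)⁻¹ y^i ι_{∂/∂x^i}` on `Ω^p ⊗ Sym^q (T_M^∨) ⊗ Λ (V^∨)`. -/
def deltaInv [Algebra ℝ A] (p q : ℕ) : Cochain A P E →ₗ[A] Cochain A P E :=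
  algebraMap ℝ A ((p + q : ℝ)⁻¹) • formToSym

end Cochain
open Cochain

variable (A P E) in
/-- The brackets of a geometrically deformed curved `L∞` structure other than `l_0, l_1, l'_1`.
By degree reasons `l` and `l'` take values in one-forms, while `ρ` and `μ` take values in functions.
The field `l n` is the bracket `l_n`, the field `l' n` is the bracket `l'_{n+1}` with `n` entries
from `T_M` and one from `V`, the field `ρ m` is `ρ_{1+m}` and the field `μ m` is `μ_{2+m}`, with `m`
entries from `T_M`. Only `l n` with `2 ≤ n` and `l' n` with `1 ≤ n` are used. -/
structure Brackets where
  l (n : ℕ) : MultilinearMap A (fun _ : Fin n => P) (P →ₗ[A] P)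
  l' (n : ℕ) : MultilinearMap A (fun _ : Fin n => P) (E →ₗ[A] P →ₗ[A] E)
  ρ (m : ℕ) : MultilinearMap A (fun _ : Fin m => P) (E →ₗ[A] P)
  μ (m : ℕ) : MultilinearMap A (fun _ : Fin m => P) (E →ₗ[A] E →ₗ[A] E)
  l_symm (n : ℕ) (σ : Equiv.Perm (Fin n)) (Y : Fin n → P) : l n (Y ∘ σ) = l n Y
  l'_symm (n : ℕ) (σ : Equiv.Perm (Fin n)) (Y : Fin n → P) : l' n (Y ∘ σ) = l' n Y
  ρ_symm (m : ℕ) (σ : Equiv.Perm (Fin m)) (Y : Fin m → P) : ρ m (Y ∘ σ) = ρ m Y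
  μ_symm (m : ℕ) (σ : Equiv.Perm (Fin m)) (Y : Fin m → P) : μ m (Y ∘ σ) = μ m Y
  μ_alt (m : ℕ) (Y : Fin m → P) (α : E) : μ m Y α α = 0

/-- `d` is `δ = dx^i ∂/∂y^i`, the operator dual to the curving `l_0 = dx^i ⊗ ∂/∂x^i`. -/
structure IsDelta (d : Cochain A P E →+ Cochain A P E) : Prop where
  odd : IsOddDerivation d
  base (f : A) : d (algebraMap A _ f) = 0
  form (θ : Module.Dual A P) : d (formGen θ) = 0
  sym (η : Module.Dual A P) : d (symGen η) = formGen η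
  fib (ξ : Module.Dual A E) : d (fibGen ξ) = 0

/-- For `n = m + 2 ≥ 2`, `d` is the component `d^∇_n + d^{∇'}_n` with coefficients the brackets
`l_n` and `l'_n`: locally
`(1/n!) (l_n)^i_{i_1…i_n} y^{i_1}⋯y^{i_n} ∂/∂y^i
  + (1/(n-1)!) (l'_n)^b_{i_1…i_{n-1},a} y^{i_1}⋯y^{i_{n-1}} v^a ∂/∂v^b`. -/
structure IsHigherPart (b : Brackets A P E) (m : ℕ) (d : Cochain A P E →+ Cochain A P E) :
    Prop where
  odd : IsOddDerivation d
  base (f : A) : d (algebraMap A _ f) = 0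
  form (θ : Module.Dual A P) : d (formGen θ) = 0
  sym_mem (η : Module.Dual A P) : d (symGen η) ∈ comp 1 (m + 2) 0
  sym (η : Module.Dual A P) (X : P) (Y : Fin (m + 2) → P) :
    symContractAll Y (formContract X (d (symGen η))) = algebraMap A _ (η (b.l (m + 2) Y X))
  fib_mem (ξ : Module.Dual A E) : d (fibGen ξ) ∈ comp 1 (m + 1) 1
  fib (ξ : Module.Dual A E) (X : P) (Y : Fin (m + 1) → P) (α : E) :
    fibContract α (symContractAll Y (formContract X (d (fibGen ξ)))) =
      algebraMap A _ (ξ (b.l' (m + 1) Y α X))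

/-- `d` is the component `d^ρ_n + d^μ_n` with `n` entries: locally
`(1/m!) (ρ_{1+m})^i_{i_1…i_m,a} y^{i_1}⋯y^{i_m} v^a ∂/∂y^i` with `m = n - 1`, plus
`(1/(m! 2!)) (μ_{2+m})^c_{i_1…i_m,a,b} y^{i_1}⋯y^{i_m} v^a ∧ v^b ∂/∂v^c` with `m = n - 2`.
The unary bracket `ρ_1` is part of the superconnection `∇ + ∇' + ρ` on `T_M ⊕ V[1]` and is dualized
as such, so that, like the connection coefficients, it enters `d` with a minus sign. -/
structure IsDeformationPart (b : Brackets A P E) (n : ℕ) (d : Cochain A P E →+ Cochain A P E) :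
    Prop where
  odd : IsOddDerivation d
  base (f : A) : d (algebraMap A _ f) = 0
  form (θ : Module.Dual A P) : d (formGen θ) = 0
  sym_zero (h : n = 0) (η : Module.Dual A P) : d (symGen η) = 0
  sym_mem (m : ℕ) (h : n = m + 1) (η : Module.Dual A P) : d (symGen η) ∈ comp 0 m 1
  sym (m : ℕ) (h : n = m + 1) (η : Module.Dual A P) (Y : Fin m → P) (α : E) :
    fibContract α (symContractAll Y (d (symGen η))) =
      (if m = 0 then -1 else 1 : ℤ) • algebraMap A _ (η (b.ρ m Y α))
  fib_zero (h : n ≤ 1) (ξ : Module.Dual A E) : d (fibGen ξ) = 0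
  fib_mem (m : ℕ) (h : n = m + 2) (ξ : Module.Dual A E) : d (fibGen ξ) ∈ comp 0 m 2
  fib (m : ℕ) (h : n = m + 2) (ξ : Module.Dual A E) (Y : Fin m → P) (α β : E) :
    fibContract β (fibContract α (symContractAll Y (d (fibGen ξ)))) =
      algebraMap A _ (ξ (b.μ m Y α β))

/-- The `δ⁻¹` gauge: `δ⁻¹` annihilates the dual brackets `d^∇_n (y^i)` and `d^{∇'}_n (v^a)` for all
`n ≥ 2`. -/
def IsDeltaInvGauge [Algebra ℝ A] (D : ℕ → Cochain A P E →+ Cochain A P E) : Prop :=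
  ∀ n, 2 ≤ n → (∀ η, deltaInv 1 n (D n (symGen η)) = 0) ∧
    ∀ ξ, deltaInv 1 (n - 1) (D n (fibGen ξ)) = 0

end Cochains

/-! ### Smooth functions, vector fields, sections and connections -/

section Geometry

open Cochain

variable (B M : Type*) [NormedAddCommGroup B] [NormedSpace ℝ B] [TopologicalSpace M]
  [ChartedSpace B M]

/-- The algebra of smooth functions on `M`. -/
abbrev SmoothFun : Type _ := C^∞⟮𝓘(ℝ, B), M; 𝓘(ℝ, ℝ), ℝ⟯

/-- The smooth sections of a bundle `V` with fibre `F`. -/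
abbrev Sect (F : Type*) [NormedAddCommGroup F] [NormedSpace ℝ F] (V : M → Type*)
    [TopologicalSpace (Bundle.TotalSpace F V)] [∀ x, TopologicalSpace (V x)]
    [FiberBundle F V] : Type _ := Cₛ^∞⟮𝓘(ℝ, B); F, V⟯

variable [IsManifold 𝓘(ℝ, B) ∞ M]

/-- The smooth vector fields on `M`. -/
abbrev VField : Type _ := Sect B M B (TangentSpace 𝓘(ℝ, B) : M → Type _)

variable {B M}
  {F : Type*} [NormedAddCommGroup F] [NormedSpace ℝ F] {V : M → Type*}
  [TopologicalSpace (Bundle.TotalSpace F V)] [∀ x, TopologicalSpace (V x)]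
  [∀ x, AddCommGroup (V x)] [∀ x, Module ℝ (V x)] [FiberBundle F V] [VectorBundle ℝ F V]

/-- Pointwise multiplication makes the smooth sections a module over the smooth functions. -/
instance Sect.instModule : Module (SmoothFun B M) (Sect B M F V) where
  smul f s := ⟨fun x => f x • s x, f.contMDiff.smul_section s.contMDiff⟩
  one_smul s := ContMDiffSection.ext fun x => one_smul ℝ (s x)
  mul_smul f g s := ContMDiffSection.ext fun x => mul_smul (f x) (g x) (s x)
  smul_zero f := ContMDiffSection.ext fun x => smul_zero (f x)
  smul_add f s t := ContMDiffSection.ext fun x => smul_add (f x) (s x) (t x)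
  add_smul f g s := ContMDiffSection.ext fun x => add_smul (f x) (g x) (s x)
  zero_smul s := ContMDiffSection.ext fun x => zero_smul ℝ (s x)

/-- The derivative `X f` of a function along a vector field. -/
def VField.deriv (X : VField B M) (f : SmoothFun B M) : SmoothFun B M :=
  ⟨fun x => mvfderiv 𝓘(ℝ, B) f x (X x), by
    have h := (f.contMDiff.contMDiff_tangentMap (m := ∞) le_rfl).comp X.contMDiff
    exact (contMDiff_snd_tangentBundle_modelSpace ℝ 𝓘(ℝ, ℝ)).comp h⟩

/-- The Lie bracket of vector fields. -/
def VField.bracket [FiniteDimensional ℝ B] (X Y : VField B M) : VField B M :=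
  ⟨VectorField.mlieBracket 𝓘(ℝ, B) X Y, fun x =>
    haveI : IsManifold 𝓘(ℝ, B) (minSmoothness ℝ 2) M := by
      rw [minSmoothness_of_isRCLikeNormedField]; infer_instance
    haveI : IsManifold 𝓘(ℝ, B) ((⊤ : ℕ∞) + 1) M := IsManifold.of_le (n := ∞) le_rfl
    haveI : CompleteSpace B := FiniteDimensional.complete ℝ B
    (X.contMDiff x).mlieBracket_vectorField (m := ⊤) (n := ⊤) (Y.contMDiff x) (by simp)⟩

variable [∀ x, IsTopologicalAddGroup (V x)] [∀ x, ContinuousSMul ℝ (V x)]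

/-- The covariant derivative `∇_X s` of a smooth section for a smooth connection. -/
def covDeriv [ContMDiffVectorBundle ∞ F V 𝓘(ℝ, B)] (cov : CovariantDerivative 𝓘(ℝ, B) F V)
    [cov.ContMDiffCovariantDerivative ∞]
    (X : VField B M) (s : Sect B M F V) : Sect B M F V :=
  ⟨fun x => cov s x (X x), by
    have h := ‹cov.ContMDiffCovariantDerivative ∞›.contMDiff.contMDiff
      (s.contMDiff.contMDiffOn (s := Set.univ))
    exact (contMDiffOn_univ.1 h).clm_bundle_apply X.contMDiff⟩

/-- The curvature `R(X, Y) s = ∇_X ∇_Y s - ∇_Y ∇_X s - ∇_{[X, Y]} s`. -/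
def curv [FiniteDimensional ℝ B] [ContMDiffVectorBundle ∞ F V 𝓘(ℝ, B)]
    (cov : CovariantDerivative 𝓘(ℝ, B) F V) [cov.ContMDiffCovariantDerivative ∞]
    (X Y : VField B M) (s : Sect B M F V) : Sect B M F V :=
  covDeriv cov X (covDeriv cov Y s) - covDeriv cov Y (covDeriv cov X s) -
    covDeriv cov (X.bracket Y) s

variable [FiniteDimensional ℝ B] [ContMDiffVectorBundle ∞ F V 𝓘(ℝ, B)]

/-- `d` is the covariant derivative on cochains: the de Rham differential on forms, and the dual
connections of `∇` and `∇'` on the generators. Locally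
`dx^k ∂/∂x^k - Γ^i_{kj} dx^k y^j ∂/∂y^i - Γ'^a_{kb} dx^k v^b ∂/∂v^a`. -/
structure IsConnectionPart
    (cov : CovariantDerivative 𝓘(ℝ, B) B (TangentSpace 𝓘(ℝ, B) : M → Type _))
    [cov.ContMDiffCovariantDerivative ∞]
    (cov' : CovariantDerivative 𝓘(ℝ, B) F V) [cov'.ContMDiffCovariantDerivative ∞]
    (d : Cochain (SmoothFun B M) (VField B M) (Sect B M F V) →+
      Cochain (SmoothFun B M) (VField B M) (Sect B M F V)) : Prop where
  odd : IsOddDerivation d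
  base_mem (f : SmoothFun B M) : d (algebraMap _ _ f) ∈ comp 1 0 0
  base (f : SmoothFun B M) (X : VField B M) :
    formContract X (d (algebraMap _ _ f)) = algebraMap _ _ (X.deriv f)
  form_mem (θ : Module.Dual (SmoothFun B M) (VField B M)) : d (formGen θ) ∈ comp 2 0 0
  form (θ : Module.Dual (SmoothFun B M) (VField B M)) (X Y : VField B M) :
    formContract Y (formContract X (d (formGen θ))) =
      algebraMap _ _ (X.deriv (θ Y) - Y.deriv (θ X) - θ (X.bracket Y))
  sym_mem (η : Module.Dual (SmoothFun B M) (VField B M)) : d (symGen η) ∈ comp 1 1 0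
  sym (η : Module.Dual (SmoothFun B M) (VField B M)) (X Y : VField B M) :
    symContract Y (formContract X (d (symGen η))) =
      algebraMap _ _ (X.deriv (η Y) - η (covDeriv cov X Y))
  fib_mem (ξ : Module.Dual (SmoothFun B M) (Sect B M F V)) : d (fibGen ξ) ∈ comp 1 0 1
  fib (ξ : Module.Dual (SmoothFun B M) (Sect B M F V)) (X : VField B M) (α : Sect B M F V) :
    fibContract α (formContract X (d (fibGen ξ))) =
      algebraMap _ _ (X.deriv (ξ α) - ξ (covDeriv cov' X α))

/-- The Chevalley--Eilenberg differential `d^∇ + d^{∇'}` of the semidirect sum: its component with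
`n` entries is `D n`, and it squares to zero. -/
structure IsSemidirectSum
    (cov : CovariantDerivative 𝓘(ℝ, B) B (TangentSpace 𝓘(ℝ, B) : M → Type _))
    [cov.ContMDiffCovariantDerivative ∞]
    (cov' : CovariantDerivative 𝓘(ℝ, B) F V) [cov'.ContMDiffCovariantDerivative ∞]
    (b : Brackets (SmoothFun B M) (VField B M) (Sect B M F V))
    (D : ℕ → Cochain (SmoothFun B M) (VField B M) (Sect B M F V) →+
      Cochain (SmoothFun B M) (VField B M) (Sect B M F V)) : Prop where
  delta : IsDelta (D 0)
  connection : IsConnectionPart cov cov' (D 1)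
  higher (m : ℕ) : IsHigherPart b m (D (m + 2))
  sq_zero (n : ℕ) : ∑ k ∈ Finset.HasAntidiagonal.antidiagonal n, (D k.1).comp (D k.2) = 0

/-- The operators `D' n = d^ρ_n + d^μ_n` solve `[d^∇ + d^{∇'}, d^ρ + d^μ] = 0`. -/
structure IsDeformationSolution
    (b : Brackets (SmoothFun B M) (VField B M) (Sect B M F V))
    (D D' : ℕ → Cochain (SmoothFun B M) (VField B M) (Sect B M F V) →+
      Cochain (SmoothFun B M) (VField B M) (Sect B M F V)) : Prop where
  part (n : ℕ) : IsDeformationPart b n (D' n)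
  commutator (n : ℕ) :
    ∑ k ∈ Finset.HasAntidiagonal.antidiagonal n, ((D k.1).comp (D' k.2) + (D' k.2).comp (D k.1)) = 0

end Geometry

end

/-!
The equations `D² = 0` and `[D, d^ρ + d^μ] = 0` are evaluated on the generators `y^i` and `v^a` and
paired with vector fields and sections, by contraction followed by the augmentation `Cochain.aug`.
Only components with at most three entries matter.

* The part of the commutator with two entries, applied to `y^i`, involves `δ` with `ρ_{1+1}`, and
  `D_1` with `ρ`; the part `d^ρ + d^μ` with no entries vanishes. It yields `ρ_{1+1} = ∇ρ`
  (`dual_rho_one`).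
* The part of the commutator with three entries, applied to `v^a`, expresses `μ_{2+1}` through the
  covariant derivative of `μ` and the bracket `l'_2` with one entry in the image of `ρ`
  (`dual_mu_one`).
* The part of `D² = 0` with two entries, applied to `v^a`, says that `δ D_2` cancels the square of
  `D_1`, which is dual to the curvature of `∇'`. This determines the antisymmetric part of `l'_2` in
  its two arguments from `T_M`. The symmetric part is what `δ⁻¹` sees, so it vanishes in the gauge.
  Hence `2 l'_2(Y, α)(X) = -R(X, Y) α` (`dual_two_mul_l'_one`), which is the source of the curvature
  terms with the factor `1/2`.

This much is algebra, over any commutative ring in place of the smooth functions (any `ℝ`-algebra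
where the gauge condition enters): all operators are handled through their Leibniz rules and their
values on generators, and a homogeneous cochain of low degree is a sum of products of generators.
Even the Leibniz rule for functions, and the fact that the Lie bracket is the commutator of
derivatives, are read off from `D_1` being a derivation that squares to zero on functions. Geometry
enters only at the end: the identities hold after applying an arbitrary linear form, and by bump
functions the linear forms separate sections (`Sect.eq_zero_of_forall_dual`).
-/

noncomputable section

/-! ### Leibniz rules -/

namespace CliffordAlgebra

variable {R N : Type*} [CommRing R] [AddCommGroup N] [Module R N] {Q : QuadraticForm R N}

theorem contractLeft_mul (φ : Module.Dual R N) (a b : CliffordAlgebra Q) :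
    contractLeft φ (a * b) = contractLeft φ a * b + involute a * contractLeft φ b := by
  induction a using left_induction with
  | algebraMap r => simp [← Algebra.smul_def, contractLeft_algebraMap]
  | add x y hx hy => simp only [add_mul, map_add, hx, hy]; abel
  | ι_mul x m hx =>
    rw [mul_assoc, contractLeft_ι_mul, hx, contractLeft_ι_mul]
    simp only [map_mul, involute_ι, sub_mul, mul_add, smul_mul_assoc, neg_mul, mul_assoc]
    abel

theorem contractLeft_involute (φ : Module.Dual R N) (a : CliffordAlgebra Q) :
    contractLeft φ (involute a) = -involute (contractLeft φ a) := by
  induction a using left_induction with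
  | algebraMap r => simp [contractLeft_algebraMap]
  | add x y hx hy => simp only [map_add, hx, hy]; abel
  | ι_mul x m hx =>
    simp only [map_mul, involute_ι, neg_mul, map_neg, contractLeft_ι_mul, hx, map_sub, map_smul,
      mul_neg]

end CliffordAlgebra

namespace Cochain

variable {A P E : Type*} [CommRing A] [AddCommGroup P] [Module A P] [AddCommGroup E] [Module A E]

theorem rTensor_contractLeft_mul (φ : Module.Dual A (Module.Dual A P × Module.Dual A E))
    (a b : Cochain A P E) :
    LinearMap.rTensor _ (CliffordAlgebra.contractLeft (Q := 0) φ) (a * b) =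
      LinearMap.rTensor _ (CliffordAlgebra.contractLeft (Q := 0) φ) a * b +
        parity a * LinearMap.rTensor _ (CliffordAlgebra.contractLeft (Q := 0) φ) b := by
  induction a using TensorProduct.induction_on with
  | zero => simp
  | add x y hx hy => simp only [add_mul, map_add, hx, hy]; abel
  | tmul x s =>
    induction b using TensorProduct.induction_on with
    | zero => simp
    | add x y hx hy => simp only [mul_add, map_add, hx, hy]; abel
    | tmul y t =>
      simp only [Algebra.TensorProduct.tmul_mul_tmul, LinearMap.rTensor_tmul, parity,
        Algebra.TensorProduct.map_tmul, AlgHom.id_apply, ← TensorProduct.add_tmul]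
      congr 1
      exact CliffordAlgebra.contractLeft_mul φ x y

theorem rTensor_contractLeft_parity (φ : Module.Dual A (Module.Dual A P × Module.Dual A E))
    (a : Cochain A P E) :
    LinearMap.rTensor _ (CliffordAlgebra.contractLeft (Q := 0) φ) (parity a) =
      -parity (LinearMap.rTensor _ (CliffordAlgebra.contractLeft (Q := 0) φ) a) := by
  induction a using TensorProduct.induction_on with
  | zero => simp
  | add x y hx hy => simp only [map_add, hx, hy]; abel
  | tmul x s =>
    simp only [LinearMap.rTensor_tmul, parity, Algebra.TensorProduct.map_tmul, AlgHom.id_apply,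
      ← TensorProduct.neg_tmul]
    congr 1
    exact CliffordAlgebra.contractLeft_involute φ x

theorem formContract_mul (X : P) (a b : Cochain A P E) :
    formContract X (a * b) = formContract X a * b + parity a * formContract X b :=
  rTensor_contractLeft_mul _ a b

theorem fibContract_mul (α : E) (a b : Cochain A P E) :
    fibContract α (a * b) = fibContract α a * b + parity a * fibContract α b :=
  rTensor_contractLeft_mul _ a b

theorem fibContract_parity (α : E) (a : Cochain A P E) :
    fibContract α (parity a) = -parity (fibContract α a) :=
  rTensor_contractLeft_parity _ a

/-- The constant term of the Taylor expansion is the identity; this gives the Leibniz rule of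
`symDeriv`. -/
theorem symTaylor_fst (Y : P) (s : SymmetricAlgebra A (Module.Dual A P)) :
    (symTaylor Y s).fst = s := by
  have h : (TrivSqZeroExt.fstHom A _ _).comp (symTaylor (A := A) Y) = AlgHom.id A _ := by
    ext η
    simp [symTaylor]
  exact DFunLike.congr_fun h s

theorem symDeriv_mul (Y : P) (s t : SymmetricAlgebra A (Module.Dual A P)) :
    symDeriv Y (s * t) = symDeriv Y s * t + s * symDeriv Y t := by
  simp only [symDeriv, LinearMap.coe_mk, AddHom.coe_mk, map_mul, TrivSqZeroExt.snd_mul,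
    symTaylor_fst, MulOpposite.smul_eq_mul_unop, MulOpposite.unop_op, smul_eq_mul]
  ring

theorem symDeriv_ι (Y : P) (η : Module.Dual A P) :
    symDeriv Y (SymmetricAlgebra.ι A _ η) = algebraMap A _ (η Y) := by
  simp [symDeriv, symTaylor, Algebra.algebraMap_eq_smul_one]

theorem symContract_mul (Y : P) (a b : Cochain A P E) :
    symContract Y (a * b) = symContract Y a * b + a * symContract Y b := by
  induction a using TensorProduct.induction_on with
  | zero => simp
  | add x y hx hy => simp only [add_mul, map_add, hx, hy]; abel
  | tmul x s =>
    induction b using TensorProduct.induction_on with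
    | zero => simp
    | add x y hx hy => simp only [mul_add, map_add, hx, hy]; abel
    | tmul y t =>
      simp only [symContract, Algebra.TensorProduct.tmul_mul_tmul, LinearMap.lTensor_tmul,
        symDeriv_mul, TensorProduct.tmul_add]

/-! ### Values on generators -/

section Generators

variable (θ η : Module.Dual A P) (ξ : Module.Dual A E) (X : P) (α : E) (f : A)

theorem algebraMap_eq_smul_one : algebraMap A (Cochain A P E) f = f • 1 :=
  Algebra.algebraMap_eq_smul_one f

theorem algebraMap_eq_tmul_one :
    algebraMap A (Cochain A P E) f = algebraMap A (ExtPart A P E) f ⊗ₜ 1 :=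
  rfl

theorem algebraMap_eq_one_tmul :
    algebraMap A (Cochain A P E) f = 1 ⊗ₜ algebraMap A _ f :=
  Algebra.TensorProduct.algebraMap_apply' f

theorem formContract_algebraMap : formContract X (algebraMap A (Cochain A P E) f) = 0 := by
  rw [algebraMap_eq_smul_one, map_smul, formContract, Algebra.TensorProduct.one_def,
    LinearMap.rTensor_tmul, CliffordAlgebra.contractLeft_one, TensorProduct.zero_tmul, smul_zero]

theorem fibContract_algebraMap : fibContract α (algebraMap A (Cochain A P E) f) = 0 := by
  rw [algebraMap_eq_smul_one, map_smul, fibContract, Algebra.TensorProduct.one_def,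
    LinearMap.rTensor_tmul, CliffordAlgebra.contractLeft_one, TensorProduct.zero_tmul, smul_zero]

theorem formContract_formGen :
    formContract X (formGen θ : Cochain A P E) = algebraMap A _ (θ X) := by
  rw [algebraMap_eq_tmul_one]
  simp only [formContract, formGen, LinearMap.comp_apply, LinearMap.flip_apply,
    TensorProduct.mk_apply, LinearMap.rTensor_tmul]
  rw [ExteriorAlgebra.ι, CliffordAlgebra.contractLeft_ι]
  rfl

theorem formContract_fibGen : formContract X (fibGen ξ : Cochain A P E) = 0 := by
  simp only [formContract, fibGen, LinearMap.comp_apply, LinearMap.flip_apply,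
    TensorProduct.mk_apply, LinearMap.rTensor_tmul]
  rw [ExteriorAlgebra.ι, CliffordAlgebra.contractLeft_ι]
  simp

theorem fibContract_fibGen :
    fibContract α (fibGen ξ : Cochain A P E) = algebraMap A _ (ξ α) := by
  rw [algebraMap_eq_tmul_one]
  simp only [fibContract, fibGen, LinearMap.comp_apply, LinearMap.flip_apply,
    TensorProduct.mk_apply, LinearMap.rTensor_tmul]
  rw [ExteriorAlgebra.ι, CliffordAlgebra.contractLeft_ι]
  rfl

theorem fibContract_formGen : fibContract α (formGen θ : Cochain A P E) = 0 := by
  simp only [fibContract, formGen, LinearMap.comp_apply, LinearMap.flip_apply,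
    TensorProduct.mk_apply, LinearMap.rTensor_tmul]
  rw [ExteriorAlgebra.ι, CliffordAlgebra.contractLeft_ι]
  simp

theorem fibContract_symGen : fibContract α (symGen η : Cochain A P E) = 0 := by
  simp [fibContract, symGen, CliffordAlgebra.contractLeft_one]

theorem symContract_symGen :
    symContract X (symGen η : Cochain A P E) = algebraMap A _ (η X) := by
  rw [algebraMap_eq_one_tmul]
  simp [symContract, symGen, symDeriv_ι]

theorem symContract_formGen : symContract X (formGen θ : Cochain A P E) = 0 := by
  simp [symContract, formGen, symDeriv]

theorem parity_formGen : parity (formGen θ : Cochain A P E) = -formGen θ := by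
  simp only [parity, formGen, LinearMap.comp_apply, LinearMap.flip_apply, TensorProduct.mk_apply,
    Algebra.TensorProduct.map_tmul, map_one, ← TensorProduct.neg_tmul]
  congr 1
  exact CliffordAlgebra.involute_ι _

theorem parity_fibGen : parity (fibGen ξ : Cochain A P E) = -fibGen ξ := by
  simp only [parity, fibGen, LinearMap.comp_apply, LinearMap.flip_apply, TensorProduct.mk_apply,
    Algebra.TensorProduct.map_tmul, map_one, ← TensorProduct.neg_tmul]
  congr 1
  exact CliffordAlgebra.involute_ι _

end Generators

variable (A P E) in
/-- The augmentation of the algebra of cochains: it is the identity on functions and annihilates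
all generators. -/
def aug : Cochain A P E →ₐ[A] A :=
  Algebra.TensorProduct.lift ExteriorAlgebra.algebraMapInv
    (SymmetricAlgebra.lift (0 : Module.Dual A P →ₗ[A] A)) fun _ _ => Commute.all _ _

theorem aug_algebraMap (f : A) : aug A P E (algebraMap A (Cochain A P E) f) = f :=
  (aug A P E).commutes f

theorem aug_formGen (θ : Module.Dual A P) : aug A P E (formGen θ) = 0 := by
  simp [aug, formGen, ExteriorAlgebra.algebraMapInv]

theorem aug_fibGen (ξ : Module.Dual A E) : aug A P E (fibGen ξ) = 0 := by
  simp [aug, fibGen, ExteriorAlgebra.algebraMapInv]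

theorem aug_symGen (η : Module.Dual A P) : aug A P E (symGen η) = 0 := by
  simp [aug, symGen]

theorem aug_parity (a : Cochain A P E) : aug A P E (parity a) = aug A P E a := by
  have h : (aug A P E).comp parity = aug A P E := by
    apply Algebra.TensorProduct.ext
    · apply CliffordAlgebra.hom_ext
      ext x
      all_goals simp [parity, aug, ExteriorAlgebra.algebraMapInv]
    · ext x
      simp [parity]
  exact DFunLike.congr_fun h a

/-- On products of three generators, `y^i ι_{∂/∂x^i}` moves the form to the symmetric factor. -/
theorem formToSym_gen (θ η : Module.Dual A P) (ξ : Module.Dual A E) :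
    formToSym (formGen θ * symGen η * fibGen ξ : Cochain A P E) =
      symGen θ * symGen η * fibGen ξ := by
  have h0 : formToSymExt (ExteriorAlgebra.ι A ((0, ξ) : Module.Dual A P × Module.Dual A E)) =
      0 := by
    refine (CliffordAlgebra.foldr'_ι _ _ _ _ _).trans ?_
    simp [formToSymStep]
  have h1 : formToSymExt (ExteriorAlgebra.ι A ((θ, 0) : Module.Dual A P × Module.Dual A E) *
      ExteriorAlgebra.ι A (0, ξ)) = ExteriorAlgebra.ι A (0, ξ) ⊗ₜ SymmetricAlgebra.ι A _ θ := by
    refine (CliffordAlgebra.foldr'_ι_mul _ _ _ _ _ _).trans ?_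
    change formToSymStep _ (_, formToSymExt (ExteriorAlgebra.ι A _)) = _
    rw [h0]
    simp [formToSymStep, ExteriorAlgebra.ι]
  simp [formGen, symGen, fibGen, formToSym, h1, Algebra.TensorProduct.tmul_mul_tmul]

/-! ### Induction over homogeneous components -/

section Induction

variable {C : Cochain A P E → Prop}

theorem comp_zero_zero_one_eq {w : Cochain A P E} (hw : w ∈ comp 0 0 1) :
    ∃ ξ, w = fibGen ξ := by
  simp only [comp, Submodule.pow_zero, Submodule.pow_one, Submodule.one_mul] at hw
  obtain ⟨ξ, rfl⟩ := hw
  exact ⟨ξ, rfl⟩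

theorem comp_one_zero_zero_eq {w : Cochain A P E} (hw : w ∈ comp 1 0 0) :
    ∃ θ, w = formGen θ := by
  simp only [comp, Submodule.pow_zero, Submodule.pow_one, Submodule.mul_one] at hw
  obtain ⟨θ, rfl⟩ := hw
  exact ⟨θ, rfl⟩

/-- A property of the elements of `Ω^1 ⊗ Sym^1 ⊗ Λ^0` may be checked on products of generators. No
closure under multiplication by functions is required, since a coefficient can be absorbed in a
generator; hence the principle applies to properties involving operators that are only additive.
The same holds for the principles for the other degrees. -/
@[elab_as_elim]
theorem comp_one_one_zero_induction (hadd : ∀ x y, C x → C y → C (x + y))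
    (hmul : ∀ θ η, C (formGen θ * symGen η)) {w} (hw : w ∈ comp 1 1 0) : C w := by
  simp only [comp, Submodule.pow_zero, Submodule.pow_one, Submodule.mul_one] at hw
  refine Submodule.mul_induction_on hw ?_ hadd
  rintro _ ⟨θ, rfl⟩ _ ⟨η, rfl⟩
  exact hmul θ η

@[elab_as_elim]
theorem comp_one_zero_one_induction (hadd : ∀ x y, C x → C y → C (x + y))
    (hmul : ∀ θ ξ, C (formGen θ * fibGen ξ)) {w} (hw : w ∈ comp 1 0 1) : C w := by
  simp only [comp, Submodule.pow_zero, Submodule.pow_one, Submodule.mul_one] at hw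
  refine Submodule.mul_induction_on hw ?_ hadd
  rintro _ ⟨θ, rfl⟩ _ ⟨ξ, rfl⟩
  exact hmul θ ξ

@[elab_as_elim]
theorem comp_zero_one_one_induction (hadd : ∀ x y, C x → C y → C (x + y))
    (hmul : ∀ η ξ, C (symGen η * fibGen ξ)) {w} (hw : w ∈ comp 0 1 1) : C w := by
  simp only [comp, Submodule.pow_zero, Submodule.pow_one, Submodule.one_mul] at hw
  refine Submodule.mul_induction_on hw ?_ hadd
  rintro _ ⟨θ, rfl⟩ _ ⟨ξ, rfl⟩
  exact hmul θ ξ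

@[elab_as_elim]
theorem comp_zero_zero_two_induction (hadd : ∀ x y, C x → C y → C (x + y))
    (hmul : ∀ ξ ζ, C (fibGen ξ * fibGen ζ)) {w} (hw : w ∈ comp 0 0 2) : C w := by
  simp only [comp, Submodule.pow_zero, Submodule.pow_succ, Submodule.one_mul] at hw
  refine Submodule.mul_induction_on hw ?_ hadd
  rintro _ ⟨θ, rfl⟩ _ ⟨ξ, rfl⟩
  exact hmul θ ξ

@[elab_as_elim]
theorem comp_one_one_one_induction (hadd : ∀ x y, C x → C y → C (x + y))
    (hmul : ∀ θ η ξ, C (formGen θ * symGen η * fibGen ξ)) {w} (hw : w ∈ comp 1 1 1) : C w := by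
  simp only [comp, Submodule.pow_one] at hw
  refine Submodule.mul_induction_on hw ?_ hadd
  rintro x hx _ ⟨ξ, rfl⟩
  refine Submodule.mul_induction_on (C := fun x => C (x * fibGen ξ)) hx ?_ fun x y hx hy => ?_
  · rintro _ ⟨θ, rfl⟩ _ ⟨η, rfl⟩
    exact hmul θ η ξ
  · rw [add_mul]
    exact hadd _ _ hx hy

@[elab_as_elim]
theorem comp_zero_one_two_induction (hadd : ∀ x y, C x → C y → C (x + y))
    (hmul : ∀ η ξ ζ, C (symGen η * (fibGen ξ * fibGen ζ))) {w} (hw : w ∈ comp 0 1 2) : C w := by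
  simp only [comp, Submodule.pow_zero, Submodule.pow_succ, Submodule.one_mul] at hw
  refine Submodule.mul_induction_on hw ?_ hadd
  rintro _ ⟨η, rfl⟩ y hy
  refine Submodule.mul_induction_on (C := fun y => C (symGen η * y)) hy ?_ fun x y hx hy => ?_
  · rintro _ ⟨θ, rfl⟩ _ ⟨ξ, rfl⟩
    exact hmul η θ ξ
  · rw [mul_add]
    exact hadd _ _ hx hy

end Induction

/-! ### Operators on low degree components

In the proofs below, `simp` expands the operators by their Leibniz rules on products of generators.
The normal form of scalars as pure tensors is switched off, since the Leibniz rules are stated for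
`algebraMap`. -/

section LowDegree

attribute [local simp] formContract_mul fibContract_mul symContract_mul fibContract_parity
  formContract_algebraMap fibContract_algebraMap formContract_formGen formContract_fibGen
  fibContract_formGen fibContract_fibGen fibContract_symGen symContract_formGen symContract_symGen
  parity_formGen parity_fibGen aug_formGen aug_fibGen aug_symGen aug_parity aug_algebraMap

variable {d : Cochain A P E →+ Cochain A P E}

/-- On `Sym^1 ⊗ Λ^1`, `δ` turns `y^i` into `dx^i`, so that contracting forms after `δ` amounts to
contracting the symmetric factor before it. -/
theorem aug_delta_zero_one_one (hd : IsDelta d) {w : Cochain A P E} (hw : w ∈ comp 0 1 1)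
    (X : P) (α : E) :
    aug A P E (fibContract α (formContract X (d w))) =
      aug A P E (fibContract α (symContract X w)) := by
  refine comp_zero_one_one_induction (fun x y hx hy => ?_) (fun η ξ => ?_) hw
  · simp [-Algebra.TensorProduct.algebraMap_apply, hx, hy]
  · simp [-Algebra.TensorProduct.algebraMap_apply, hd.odd _ _, hd.sym, hd.fib]

theorem aug_delta_zero_one_two (hd : IsDelta d) {w : Cochain A P E} (hw : w ∈ comp 0 1 2)
    (X : P) (α β : E) :
    aug A P E (fibContract β (fibContract α (formContract X (d w)))) =
      aug A P E (fibContract β (fibContract α (symContract X w))) := by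
  refine comp_zero_one_two_induction (fun x y hx hy => ?_) (fun η ξ ζ => ?_) hw
  · simp [-Algebra.TensorProduct.algebraMap_apply, hx, hy]
  · simp [-Algebra.TensorProduct.algebraMap_apply, hd.odd _ _, hd.sym, hd.fib]

theorem aug_delta_one_one_one (hd : IsDelta d) {w : Cochain A P E} (hw : w ∈ comp 1 1 1)
    (X Y : P) (α : E) :
    aug A P E (fibContract α (formContract Y (formContract X (d w)))) =
      aug A P E (fibContract α (symContract X (formContract Y w))) -
        aug A P E (fibContract α (symContract Y (formContract X w))) := by
  refine comp_one_one_one_induction (fun x y hx hy => ?_) (fun θ η ξ => ?_) hw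
  · simp only [map_add, hx, hy]; ring
  · simp [-Algebra.TensorProduct.algebraMap_apply, hd.odd _ _, hd.sym, hd.fib, hd.form]
    ring

/-- On `Ω^1 ⊗ Sym^1 ⊗ Λ^1`, the operator `y^i ι_{∂/∂x^i}` symmetrizes in the two vector fields. -/
theorem aug_formToSym_one_one_one {w : Cochain A P E} (hw : w ∈ comp 1 1 1) (X Y : P) (α : E) :
    aug A P E (fibContract α (symContract Y (symContract X (formToSym w)))) =
      aug A P E (fibContract α (symContract Y (formContract X w))) +
        aug A P E (fibContract α (symContract X (formContract Y w))) := by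
  refine comp_one_one_one_induction (fun x y hx hy => ?_) (fun θ η ξ => ?_) hw
  · simp only [map_add, hx, hy]; ring
  · simp [-Algebra.TensorProduct.algebraMap_apply, formToSym_gen]
    ring

section Anchor

variable {ρ : E → P}

/-- An operator dual to `-ρ` replaces an entry of the symmetric factor by a value of `ρ`. The sign
of `ρ` cancels against the one from passing the form. -/
theorem aug_anchor_one_one_zero (hodd : IsOddDerivation d) (hform : ∀ θ, d (formGen θ) = 0)
    (hsym : ∀ η α, aug A P E (fibContract α (d (symGen η))) = -η (ρ α))
    {w : Cochain A P E} (hw : w ∈ comp 1 1 0) (X : P) (α : E) :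
    aug A P E (fibContract α (formContract X (d w))) =
      aug A P E (symContract (ρ α) (formContract X w)) := by
  refine comp_one_one_zero_induction (fun x y hx hy => ?_) (fun θ η => ?_) hw
  · simp [-Algebra.TensorProduct.algebraMap_apply, hx, hy]
  · simp [-Algebra.TensorProduct.algebraMap_apply, hodd _ _, hform, hsym]

theorem aug_anchor_one_one_one (hodd : IsOddDerivation d) (hform : ∀ θ, d (formGen θ) = 0)
    (hfib : ∀ ξ, d (fibGen ξ) = 0)
    (hsym : ∀ η α, aug A P E (fibContract α (d (symGen η))) = -η (ρ α))
    {w : Cochain A P E} (hw : w ∈ comp 1 1 1) (X : P) (α β : E) :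
    aug A P E (fibContract β (fibContract α (formContract X (d w)))) =
      aug A P E (fibContract β (symContract (ρ α) (formContract X w))) -
        aug A P E (fibContract α (symContract (ρ β) (formContract X w))) := by
  refine comp_one_one_one_induction (fun x y hx hy => ?_) (fun θ η ξ => ?_) hw
  · simp only [map_add, hx, hy]; ring
  · simp [-Algebra.TensorProduct.algebraMap_apply, hodd _ _, hform, hfib, hsym]
    ring

/-- An operator whose value on the generators `v^a` is dual to `μ` acts on `Ω^1 ⊗ Λ^1` by inserting
`μ`, with a sign from passing the form. -/
theorem aug_product_one_zero_one {μ : E → E → E} (hodd : IsOddDerivation d)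
    (hform : ∀ θ, d (formGen θ) = 0)
    (hfib : ∀ ξ α β, aug A P E (fibContract β (fibContract α (d (fibGen ξ)))) = ξ (μ α β))
    {w : Cochain A P E} (hw : w ∈ comp 1 0 1) (X : P) (α β : E) :
    aug A P E (fibContract β (fibContract α (formContract X (d w)))) =
      -aug A P E (fibContract (μ α β) (formContract X w)) := by
  refine comp_one_zero_one_induction (fun x y hx hy => ?_) (fun θ ξ => ?_) hw
  · simp only [map_add, hx, hy]; ring
  · simp [-Algebra.TensorProduct.algebraMap_apply, hodd _ _, hform, hfib]

end Anchor

/-- `d` has the components of a covariant derivative on cochains, where `L` differentiates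
functions, `br` is the bracket of vector fields, and `nab` and `nab'` are the connections on `T_M`
and `V`. No laws are imposed on these four operations: the ones that matter follow from the Leibniz
rule of `d` and from the vanishing of its square on functions. -/
structure IsConnectionOperator (L : P → A → A) (br : P → P → P) (nab : P → P → P)
    (nab' : P → E → E) (d : Cochain A P E →+ Cochain A P E) : Prop where
  odd : IsOddDerivation d
  base_mem (f : A) : d (algebraMap A _ f) ∈ comp 1 0 0
  base (f : A) (X : P) : aug A P E (formContract X (d (algebraMap A _ f))) = L X f
  form (θ : Module.Dual A P) (X Y : P) :
    aug A P E (formContract Y (formContract X (d (formGen θ)))) =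
      L X (θ Y) - L Y (θ X) - θ (br X Y)
  sym_mem (η : Module.Dual A P) : d (symGen η) ∈ comp 1 1 0
  sym (η : Module.Dual A P) (X Y : P) :
    aug A P E (symContract Y (formContract X (d (symGen η)))) = L X (η Y) - η (nab X Y)
  fib_mem (ξ : Module.Dual A E) : d (fibGen ξ) ∈ comp 1 0 1
  fib (ξ : Module.Dual A E) (X : P) (α : E) :
    aug A P E (fibContract α (formContract X (d (fibGen ξ)))) = L X (ξ α) - ξ (nab' X α)

variable {L : P → A → A} {br : P → P → P} {nab : P → P → P} {nab' : P → E → E}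

namespace IsConnectionOperator

/-- The Leibniz rule for the derivative of functions follows from that of the operator `d`. -/
theorem L_mul (h : IsConnectionOperator L br nab nab' d) (X : P) (f g : A) :
    L X (f * g) = L X f * g + f * L X g := by
  simp only [← h.base, map_mul, h.odd _ _]
  simp [-Algebra.TensorProduct.algebraMap_apply, formContract_mul]

theorem L_add (h : IsConnectionOperator L br nab nab' d) (X : P) (f g : A) :
    L X (f + g) = L X f + L X g := by
  simp [-Algebra.TensorProduct.algebraMap_apply, ← h.base]

theorem L_neg (h : IsConnectionOperator L br nab nab' d) (X : P) (f : A) :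
    L X (-f) = -L X f := by
  simp [-Algebra.TensorProduct.algebraMap_apply, ← h.base]

theorem L_sub (h : IsConnectionOperator L br nab nab' d) (X : P) (f g : A) :
    L X (f - g) = L X f - L X g := by
  simp [-Algebra.TensorProduct.algebraMap_apply, ← h.base]

/-- On `Λ^2 (V^∨)`, a connection operator is the dual connection. -/
theorem aug_zero_zero_two (h : IsConnectionOperator L br nab nab' d) {w : Cochain A P E}
    (hw : w ∈ comp 0 0 2) (X : P) (α β : E) :
    aug A P E (fibContract β (fibContract α (formContract X (d w)))) =
      L X (aug A P E (fibContract β (fibContract α w))) -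
        aug A P E (fibContract β (fibContract (nab' X α) w)) -
        aug A P E (fibContract (nab' X β) (fibContract α w)) := by
  refine comp_zero_zero_two_induction (fun x y hx hy => ?_) (fun ξ ζ => ?_) hw
  · simp only [map_add, hx, hy, h.L_add]; ring
  · simp [-Algebra.TensorProduct.algebraMap_apply, h.odd _ _, h.fib, h.L_mul, h.L_add, h.L_neg]
    ring

/-- The Cartan formula for the exterior covariant derivative of a one-form with values in `V^∨`. -/
theorem aug_one_zero_one (h : IsConnectionOperator L br nab nab' d) {w : Cochain A P E}
    (hw : w ∈ comp 1 0 1) (X Y : P) (α : E) :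
    aug A P E (fibContract α (formContract Y (formContract X (d w)))) =
      L X (aug A P E (fibContract α (formContract Y w))) -
        L Y (aug A P E (fibContract α (formContract X w))) -
        aug A P E (fibContract α (formContract (br X Y) w)) -
        aug A P E (fibContract (nab' X α) (formContract Y w)) +
        aug A P E (fibContract (nab' Y α) (formContract X w)) := by
  refine comp_one_zero_one_induction (fun x y hx hy => ?_) (fun θ ξ => ?_) hw
  · simp only [map_add, hx, hy, h.L_add]; ring
  · simp [-Algebra.TensorProduct.algebraMap_apply, h.odd _ _, h.fib, h.form, h.L_mul]
    ring

/-- As soon as `d` squares to zero on functions, `br` is the commutator of vector fields. -/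
theorem L_bracket (h : IsConnectionOperator L br nab nab' d)
    (hsq : ∀ f, d (d (algebraMap A _ f)) = 0) (X Y : P) (f : A) :
    L (br X Y) f = L X (L Y f) - L Y (L X f) := by
  obtain ⟨θ, hθ⟩ := comp_one_zero_zero_eq (h.base_mem f)
  have hL (Z : P) : L Z f = θ Z := by
    rw [← h.base, hθ]
    simp [-Algebra.TensorProduct.algebraMap_apply]
  have h0 := h.form θ X Y
  rw [← hθ, hsq] at h0
  simp only [hL, map_zero] at h0 ⊢
  linear_combination h0

/-- The square of a connection operator on the generators `v^a` is dual to the curvature. -/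
theorem aug_sq_fib (h : IsConnectionOperator L br nab nab' d)
    (hsq : ∀ f, d (d (algebraMap A _ f)) = 0) (ξ : Module.Dual A E) (X Y : P) (α : E) :
    aug A P E (fibContract α (formContract Y (formContract X (d (d (fibGen ξ)))))) =
      -ξ (nab' X (nab' Y α) - nab' Y (nab' X α) - nab' (br X Y) α) := by
  rw [h.aug_one_zero_one (h.fib_mem ξ)]
  simp only [h.fib, h.L_sub, h.L_bracket hsq, map_sub]
  ring

end IsConnectionOperator

end LowDegree

/-! ### Components with few entries of the operators -/

/-- Functions and generators generate the algebra of cochains, so an odd derivation that annihilates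
them is zero. -/
theorem IsOddDerivation.eq_zero {d : Cochain A P E →+ Cochain A P E} (hodd : IsOddDerivation d)
    (hbase : ∀ f, d (algebraMap A _ f) = 0) (hform : ∀ θ, d (formGen θ) = 0)
    (hsym : ∀ η, d (symGen η) = 0) (hfib : ∀ ξ, d (fibGen ξ) = 0) : d = 0 := by
  have hmul (a b : Cochain A P E) (ha : d a = 0) (hb : d b = 0) : d (a * b) = 0 := by
    rw [hodd, ha, hb, zero_mul, mul_zero, add_zero]
  have hext (x : ExtPart A P E) : d (x ⊗ₜ 1) = 0 := by
    induction x using CliffordAlgebra.left_induction with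
    | algebraMap r => exact hbase r
    | add x y hx hy => rw [TensorProduct.add_tmul, map_add, hx, hy, add_zero]
    | ι_mul x m hx =>
      have hm : (CliffordAlgebra.ι 0 m * x) ⊗ₜ[A] (1 : SymmetricAlgebra A (Module.Dual A P)) =
          (formGen m.1 + fibGen m.2 : Cochain A P E) * (x ⊗ₜ 1) := by
        simp only [formGen, fibGen, LinearMap.comp_apply, LinearMap.flip_apply,
          TensorProduct.mk_apply, ← TensorProduct.add_tmul, ← map_add,
          Algebra.TensorProduct.tmul_mul_tmul, mul_one]
        simp [ExteriorAlgebra.ι]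
      rw [hm]
      refine hmul _ _ ?_ hx
      rw [map_add, hform, hfib, add_zero]
  have hsymm (s : SymmetricAlgebra A (Module.Dual A P)) : d (1 ⊗ₜ s) = 0 := by
    induction s using SymmetricAlgebra.induction with
    | algebraMap r =>
      rw [← algebraMap_eq_one_tmul]
      exact hbase r
    | ι η => exact hsym η
    | mul s t hs ht =>
      have h := hmul _ _ hs ht
      rwa [Algebra.TensorProduct.tmul_mul_tmul, mul_one] at h
    | add s t hs ht => rw [TensorProduct.tmul_add, map_add, hs, ht, add_zero]
  ext a
  induction a using TensorProduct.induction_on with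
  | zero => simp
  | add x y hx hy => rw [map_add, hx, hy, map_add]
  | tmul x s =>
    have h := hmul _ _ (hext x) (hsymm s)
    rwa [Algebra.TensorProduct.tmul_mul_tmul, mul_one, one_mul] at h

theorem symContractAll_nil (Y : Fin 0 → P) (w : Cochain A P E) : symContractAll Y w = w := by
  simp [symContractAll]

theorem symContractAll_singleton (Y : P) (w : Cochain A P E) :
    symContractAll ![Y] w = symContract Y w := by
  simp [symContractAll]

end Cochain

section

open Cochain

variable {A P E : Type*} [CommRing A] [AddCommGroup P] [Module A P] [AddCommGroup E] [Module A E]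
  {b : Brackets A P E} {D D' : ℕ → Cochain A P E →+ Cochain A P E}

namespace IsDeformationPart

variable {d : Cochain A P E →+ Cochain A P E}

theorem eq_zero (h : IsDeformationPart b 0 d) : d = 0 :=
  h.odd.eq_zero h.base h.form (h.sym_zero rfl) (h.fib_zero zero_le_one)

theorem aug_sym_zero (h : IsDeformationPart b 1 d) (η : Module.Dual A P) (α : E) :
    aug A P E (fibContract α (d (symGen η))) = -η (b.ρ 0 ![] α) := by
  have h := h.sym 0 rfl η ![] α
  rw [symContractAll_nil] at h
  rw [h, if_pos rfl, neg_one_smul, map_neg, aug_algebraMap]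

theorem aug_sym_one (h : IsDeformationPart b 2 d) (η : Module.Dual A P) (X : P) (α : E) :
    aug A P E (fibContract α (symContract X (d (symGen η)))) = η (b.ρ 1 ![X] α) := by
  have h := h.sym 1 rfl η ![X] α
  rw [symContractAll_singleton] at h
  rw [h, if_neg one_ne_zero, one_smul, aug_algebraMap]

theorem aug_fib_zero (h : IsDeformationPart b 2 d) (ξ : Module.Dual A E) (α β : E) :
    aug A P E (fibContract β (fibContract α (d (fibGen ξ)))) = ξ (b.μ 0 ![] α β) := by
  have h := h.fib 0 rfl ξ ![] α β
  rw [symContractAll_nil] at h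
  rw [h, aug_algebraMap]

theorem aug_fib_one (h : IsDeformationPart b 3 d) (ξ : Module.Dual A E) (X : P) (α β : E) :
    aug A P E (fibContract β (fibContract α (symContract X (d (fibGen ξ))))) =
      ξ (b.μ 1 ![X] α β) := by
  have h := h.fib 1 rfl ξ ![X] α β
  rw [symContractAll_singleton] at h
  rw [h, aug_algebraMap]

end IsDeformationPart

theorem IsHigherPart.aug_fib_one {d : Cochain A P E →+ Cochain A P E} (h : IsHigherPart b 0 d)
    (ξ : Module.Dual A E) (X Y : P) (α : E) :
    aug A P E (fibContract α (symContract Y (formContract X (d (fibGen ξ))))) =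
      ξ (b.l' 1 ![Y] α X) := by
  have h := h.fib ξ X ![Y] α
  rw [symContractAll_singleton] at h
  rw [h, aug_algebraMap]

/-! ### The equations for the lower brackets, paired with linear forms -/

variable {L : P → A → A} {br : P → P → P} {nab : P → P → P} {nab' : P → E → E}

theorem commutator_two (h0 : IsDeformationPart b 0 (D' 0))
    (hc : ∑ k ∈ Finset.HasAntidiagonal.antidiagonal 2,
      ((D k.1).comp (D' k.2) + (D' k.2).comp (D k.1)) = 0) (w : Cochain A P E) :
    D 0 (D' 2 w) + D' 2 (D 0 w) + (D 1 (D' 1 w) + D' 1 (D 1 w)) = 0 := by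
  rw [Finset.Nat.sum_antidiagonal_eq_sum_range_succ_mk] at hc
  simpa [Finset.sum_range_succ, h0.eq_zero] using DFunLike.congr_fun hc w

theorem commutator_three (h0 : IsDeformationPart b 0 (D' 0))
    (hc : ∑ k ∈ Finset.HasAntidiagonal.antidiagonal 3,
      ((D k.1).comp (D' k.2) + (D' k.2).comp (D k.1)) = 0) (w : Cochain A P E) :
    D 0 (D' 3 w) + D' 3 (D 0 w) + (D 1 (D' 2 w) + D' 2 (D 1 w)) +
      (D 2 (D' 1 w) + D' 1 (D 2 w)) = 0 := by
  rw [Finset.Nat.sum_antidiagonal_eq_sum_range_succ_mk] at hc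
  simpa [Finset.sum_range_succ, h0.eq_zero] using DFunLike.congr_fun hc w

theorem square_two
    (hsq : ∑ k ∈ Finset.HasAntidiagonal.antidiagonal 2, (D k.1).comp (D k.2) = 0)
    (w : Cochain A P E) : D 0 (D 2 w) + D 1 (D 1 w) + D 2 (D 0 w) = 0 := by
  rw [Finset.Nat.sum_antidiagonal_eq_sum_range_succ_mk] at hsq
  simpa [Finset.sum_range_succ] using DFunLike.congr_fun hsq w

/-- The component with two entries of `[D, d^ρ + d^μ] = 0`, evaluated on `y^i`, paired with `X` and
`α`: `δ` extracts `ρ_{1+1}`, and `D_1` and `d^ρ_1` produce the covariant derivative of `ρ`. -/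
theorem dual_rho_one (h0 : IsDelta (D 0)) (h1 : IsConnectionOperator L br nab nab' (D 1))
    (hp : ∀ n, IsDeformationPart b n (D' n))
    (hc : ∀ n, ∑ k ∈ Finset.HasAntidiagonal.antidiagonal n,
      ((D k.1).comp (D' k.2) + (D' k.2).comp (D k.1)) = 0)
    (η : Module.Dual A P) (X : P) (α : E) :
    η (b.ρ 1 ![X] α) = η (nab X (b.ρ 0 ![] α)) - η (b.ρ 0 ![] (nab' X α)) := by
  obtain ⟨ξ, hξ⟩ := comp_zero_zero_one_eq ((hp 1).sym_mem 0 rfl η)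
  have hξ' (γ : E) : ξ γ = -η (b.ρ 0 ![] γ) := by
    rw [← (hp 1).aug_sym_zero, hξ, fibContract_fibGen, aug_algebraMap]
  have h := congrArg (fun w => aug A P E (fibContract α (formContract X w)))
    (commutator_two (hp 0) (hc 2) (symGen η))
  simp only [h0.sym, (hp 2).form, hξ, map_add, map_zero, add_zero, h1.fib, hξ',
    aug_delta_zero_one_one h0 ((hp 2).sym_mem 1 rfl η), (hp 2).aug_sym_one,
    aug_anchor_one_one_zero (hp 1).odd (hp 1).form (hp 1).aug_sym_zero (h1.sym_mem η), h1.sym,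
    h1.L_neg] at h
  linear_combination h

/-- The component with three entries of `[D, d^ρ + d^μ] = 0`, evaluated on `v^a`, paired with `X`,
`α` and `β`: `δ` extracts `μ_{2+1}`, `D_1` and `d^μ_2` produce the covariant derivative of `μ`, and
`D_2` and `d^ρ_1` produce `l'_2` with one entry in the image of `ρ`. -/
theorem dual_mu_one (h0 : IsDelta (D 0)) (h1 : IsConnectionOperator L br nab nab' (D 1))
    (h2 : IsHigherPart b 0 (D 2)) (hp : ∀ n, IsDeformationPart b n (D' n))
    (hc : ∀ n, ∑ k ∈ Finset.HasAntidiagonal.antidiagonal n,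
      ((D k.1).comp (D' k.2) + (D' k.2).comp (D k.1)) = 0)
    (ξ : Module.Dual A E) (X : P) (α β : E) :
    ξ (b.μ 1 ![X] α β) =
      -(ξ (nab' X (b.μ 0 ![] α β)) - ξ (b.μ 0 ![] (nab' X α) β) - ξ (b.μ 0 ![] α (nab' X β))) -
        ξ (b.l' 1 ![b.ρ 0 ![] α] β X) + ξ (b.l' 1 ![b.ρ 0 ![] β] α X) := by
  have h := congrArg (fun w => aug A P E (fibContract β (fibContract α (formContract X w))))
    (commutator_three (hp 0) (hc 3) (fibGen ξ))
  simp only [h0.fib, (hp 1).fib_zero le_rfl, map_add, map_zero, add_zero, zero_add,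
    aug_delta_zero_one_two h0 ((hp 3).fib_mem 1 rfl ξ), (hp 3).aug_fib_one,
    h1.aug_zero_zero_two ((hp 2).fib_mem 0 rfl ξ), (hp 2).aug_fib_zero,
    aug_product_one_zero_one (hp 2).odd (hp 2).form (hp 2).aug_fib_zero (h1.fib_mem ξ), h1.fib,
    aug_anchor_one_one_one (hp 1).odd (hp 1).form ((hp 1).fib_zero le_rfl) (hp 1).aug_sym_zero
      (h2.fib_mem ξ), h2.aug_fib_one] at h
  linear_combination h

/-- The component with two entries of `D² = 0`, evaluated on `v^a`, says that the curvature is the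
antisymmetric part of `l'_2`, and the gauge condition makes the symmetric part vanish. -/
theorem dual_two_mul_l'_one [Algebra ℝ A] (h0 : IsDelta (D 0))
    (h1 : IsConnectionOperator L br nab nab' (D 1)) (h2 : IsHigherPart b 0 (D 2))
    (hsq : ∑ k ∈ Finset.HasAntidiagonal.antidiagonal 2, (D k.1).comp (D k.2) = 0)
    (hgauge : IsDeltaInvGauge D) (ξ : Module.Dual A E) (X Y : P) (α : E) :
    2 * ξ (b.l' 1 ![Y] α X) =
      -ξ (nab' X (nab' Y α) - nab' Y (nab' X α) - nab' (br X Y) α) := by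
  have hbase (f : A) : D 1 (D 1 (algebraMap A _ f)) = 0 := by
    simpa [h0.base, h2.base, -Algebra.TensorProduct.algebraMap_apply] using
      square_two hsq (algebraMap A _ f)
  have h := congrArg (fun w => aug A P E (fibContract α (formContract Y (formContract X w))))
    (square_two hsq (fibGen ξ))
  simp only [h0.fib, map_add, map_zero, add_zero, h1.aug_sq_fib hbase,
    aug_delta_one_one_one h0 (h2.fib_mem ξ), h2.aug_fib_one] at h
  have hg : formToSym (D 2 (fibGen ξ)) = 0 := by
    have hg := (hgauge 2 le_rfl).2 ξ
    -- The factor `(p + q)⁻¹` of `δ⁻¹` is `1/2`, hence invertible.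
    have hr : (2 : ℝ) * ((1 : ℕ) + (2 - 1 : ℕ) : ℝ)⁻¹ = 1 := by norm_num
    rw [deltaInv, LinearMap.smul_apply] at hg
    rw [← one_smul A (formToSym _), ← map_one (algebraMap ℝ A), ← hr, map_mul, mul_smul, hg,
      smul_zero]
  -- The gauge condition makes `l'_2` antisymmetric in its two arguments from `T_M`.
  have hs := aug_formToSym_one_one_one (h2.fib_mem ξ) X Y α
  simp only [hg, map_zero, h2.aug_fib_one] at hs
  linear_combination -h - hs

end

/-! ### Linear forms on smooth sections -/

theorem Sect.dual_smul_real
    {B : Type*} [NormedAddCommGroup B] [NormedSpace ℝ B]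
    {M : Type*} [TopologicalSpace M] [ChartedSpace B M]
    {F : Type*} [NormedAddCommGroup F] [NormedSpace ℝ F]
    {V : M → Type*} [TopologicalSpace (Bundle.TotalSpace F V)]
    [∀ x, TopologicalSpace (V x)] [∀ x, AddCommGroup (V x)] [∀ x, Module ℝ (V x)]
    [FiberBundle F V] [VectorBundle ℝ F V] [∀ x, IsTopologicalAddGroup (V x)]
    (ξ : Module.Dual (SmoothFun B M) (Sect B M F V)) (c : ℝ) (s : Sect B M F V) :
    ξ (c • s) = algebraMap ℝ (SmoothFun B M) c * ξ s :=
  map_smul ξ (algebraMap ℝ (SmoothFun B M) c) s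

section

open Bundle

variable {B : Type*} [NormedAddCommGroup B] [NormedSpace ℝ B] [FiniteDimensional ℝ B]
    {M : Type*} [TopologicalSpace M] [ChartedSpace B M] [IsManifold 𝓘(ℝ, B) ∞ M]
    [T2Space M]
    {F : Type*} [NormedAddCommGroup F] [NormedSpace ℝ F]
    {V : M → Type*} [TopologicalSpace (Bundle.TotalSpace F V)]
    [∀ x, TopologicalSpace (V x)] [∀ x, AddCommGroup (V x)] [∀ x, Module ℝ (V x)]
    [FiberBundle F V] [VectorBundle ℝ F V]

/-- The linear form `s ↦ ψ φ(s)` on global sections, where `φ` is a linear form on the model fibre,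
applied in the trivialization at `x`, and `ψ` is a bump function supported where the latter is
defined. -/
def Sect.localDual [ContMDiffVectorBundle ∞ F V 𝓘(ℝ, B)] (x : M) (ψ : SmoothBumpFunction 𝓘(ℝ, B) x)
    (hψ : tsupport ψ ⊆ (trivializationAt F V x).baseSet) (φ : F →L[ℝ] ℝ) :
    Module.Dual (SmoothFun B M) (Sect B M F V) where
  toFun s := ⟨fun y => ψ y • φ ((trivializationAt F V x).continuousLinearMapAt ℝ y (s y)), by
    refine contMDiff_of_tsupport fun y hy => ?_
    have hy' : y ∈ (trivializationAt F V x).baseSet := hψ (tsupport_smul_subset_left _ _ hy)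
    refine ψ.contMDiffAt.smul (φ.contMDiff.contMDiffAt.comp y ?_)
    have h := ((trivializationAt F V x).contMDiffAt_section_iff hy').1 (s.contMDiff y)
    refine h.congr_of_eventuallyEq ?_
    filter_upwards [(trivializationAt F V x).open_baseSet.mem_nhds hy'] with z hz
    exact congrFun ((trivializationAt F V x).coe_linearMapAt_of_mem hz) (s z)⟩
  map_add' s t := by
    ext y
    refine (congrArg (fun u => ψ y • φ u) (map_add _ (s y) (t y))).trans ?_
    rw [map_add, smul_add]
    rfl
  map_smul' f s := by
    ext y
    refine (congrArg (fun u => ψ y • φ u) (map_smul _ (f y) (s y))).trans ?_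
    rw [map_smul, smul_comm]
    rfl

/-- Linear forms over the smooth functions separate the smooth sections. -/
theorem Sect.eq_zero_of_forall_dual [ContMDiffVectorBundle ∞ F V 𝓘(ℝ, B)] (s : Sect B M F V)
    (hs : ∀ ξ : Module.Dual (SmoothFun B M) (Sect B M F V), ξ s = 0) : s = 0 := by
  ext x
  have hx : x ∈ (trivializationAt F V x).baseSet := FiberBundle.mem_baseSet_trivializationAt' x
  obtain ⟨ψ, -, hψ⟩ := (SmoothBumpFunction.nhds_basis_tsupport (I := 𝓘(ℝ, B)) x).mem_iff.1
    ((trivializationAt F V x).open_baseSet.mem_nhds hx)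
  have h0 : (trivializationAt F V x).continuousLinearMapAt ℝ x (s x) = 0 := by
    refine SeparatingDual.eq_zero_of_forall_dual_eq_zero (R := ℝ) fun φ => ?_
    have h : ψ x • φ ((trivializationAt F V x).continuousLinearMapAt ℝ x (s x)) = 0 :=
      DFunLike.congr_fun (hs (localDual x ψ hψ φ)) x
    rwa [ψ.eq_one, one_smul] at h
  rw [← (trivializationAt F V x).symmL_continuousLinearMapAt (R := ℝ) hx (s x), h0, map_zero]
  rfl

theorem Sect.eq_of_forall_dual [ContMDiffVectorBundle ∞ F V 𝓘(ℝ, B)] {s t : Sect B M F V}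
    (h : ∀ ξ : Module.Dual (SmoothFun B M) (Sect B M F V), ξ s = ξ t) : s = t :=
  sub_eq_zero.1 (Sect.eq_zero_of_forall_dual _ fun ξ => by rw [map_sub, h, sub_self])

end

/-! ### From the connections to the algebraic operators -/

section

open Cochain

variable {B : Type*} [NormedAddCommGroup B] [NormedSpace ℝ B] [FiniteDimensional ℝ B]
    {M : Type*} [TopologicalSpace M] [ChartedSpace B M] [IsManifold 𝓘(ℝ, B) ∞ M]
    {F : Type*} [NormedAddCommGroup F] [NormedSpace ℝ F]
    {V : M → Type*} [TopologicalSpace (Bundle.TotalSpace F V)]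
    [∀ x, TopologicalSpace (V x)] [∀ x, AddCommGroup (V x)] [∀ x, Module ℝ (V x)]
    [∀ x, IsTopologicalAddGroup (V x)] [∀ x, ContinuousSMul ℝ (V x)]
    [FiberBundle F V] [VectorBundle ℝ F V] [ContMDiffVectorBundle ∞ F V 𝓘(ℝ, B)]
    {cov : CovariantDerivative 𝓘(ℝ, B) B (TangentSpace 𝓘(ℝ, B) : M → Type _)}
    [cov.ContMDiffCovariantDerivative ∞]
    {cov' : CovariantDerivative 𝓘(ℝ, B) F V} [cov'.ContMDiffCovariantDerivative ∞]

theorem IsConnectionPart.isConnectionOperator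
    {d : Cochain (SmoothFun B M) (VField B M) (Sect B M F V) →+
      Cochain (SmoothFun B M) (VField B M) (Sect B M F V)} (h : IsConnectionPart cov cov' d) :
    IsConnectionOperator VField.deriv VField.bracket (covDeriv cov) (covDeriv cov') d where
  odd := h.odd
  base_mem := h.base_mem
  base f X := by rw [h.base, aug_algebraMap]
  form θ X Y := by rw [h.form, aug_algebraMap]
  sym_mem := h.sym_mem
  sym η X Y := by rw [h.sym, aug_algebraMap]
  fib_mem := h.fib_mem
  fib ξ X α := by rw [h.fib, aug_algebraMap]

end

end

theorem mainTheorem9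
    {B : Type*} [NormedAddCommGroup B] [NormedSpace ℝ B] [FiniteDimensional ℝ B]
    {M : Type*} [TopologicalSpace M] [ChartedSpace B M] [IsManifold 𝓘(ℝ, B) ∞ M]
    [T2Space M] [SigmaCompactSpace M]
    {F : Type*} [NormedAddCommGroup F] [NormedSpace ℝ F] [FiniteDimensional ℝ F]
    {V : M → Type*} [TopologicalSpace (Bundle.TotalSpace F V)]
    [∀ x, TopologicalSpace (V x)] [∀ x, AddCommGroup (V x)] [∀ x, Module ℝ (V x)]
    [∀ x, IsTopologicalAddGroup (V x)] [∀ x, ContinuousSMul ℝ (V x)]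
    [FiberBundle F V] [VectorBundle ℝ F V] [ContMDiffVectorBundle ∞ F V 𝓘(ℝ, B)]
    (cov : CovariantDerivative 𝓘(ℝ, B) B (TangentSpace 𝓘(ℝ, B) : M → Type _))
    [cov.ContMDiffCovariantDerivative ∞]
    (htorsion : ∀ X Y : VField B M, covDeriv cov X Y - covDeriv cov Y X = X.bracket Y)
    (cov' : CovariantDerivative 𝓘(ℝ, B) F V) [cov'.ContMDiffCovariantDerivative ∞]
    (ρ : Sect B M F V →ₗ[SmoothFun B M] VField B M)
    (μ : Sect B M F V →ₗ[SmoothFun B M] Sect B M F V →ₗ[SmoothFun B M] Sect B M F V)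
    (b : Brackets (SmoothFun B M) (VField B M) (Sect B M F V))
    (D D' : ℕ → Cochain (SmoothFun B M) (VField B M) (Sect B M F V) →+
      Cochain (SmoothFun B M) (VField B M) (Sect B M F V))
    (hD : IsSemidirectSum cov cov' b D) (hgauge : IsDeltaInvGauge D)
    (hD' : IsDeformationSolution b D D')
    (hρ : b.ρ 0 ![] = ρ) (hμ : b.μ 0 ![] = μ)
    (X : VField B M) (α β : Sect B M F V) :
    b.ρ 1 ![X] α = covDeriv cov X (ρ α) - ρ (covDeriv cov' X α) ∧
    b.μ 1 ![X] α β =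
      -(covDeriv cov' X (μ α β) - μ (covDeriv cov' X α) β - μ α (covDeriv cov' X β)) +
        (1 / 2 : ℝ) • curv cov' X (ρ α) β - (1 / 2 : ℝ) • curv cov' X (ρ β) α := by
  have hconn := hD.connection.isConnectionOperator
  subst hρ hμ
  refine ⟨Sect.eq_of_forall_dual fun η => ?_, Sect.eq_of_forall_dual fun ξ => ?_⟩
  · rw [map_sub]
    exact dual_rho_one hD.delta hconn hD'.part hD'.commutator η X α
  · have hl' (Y : VField B M) (γ : Sect B M F V) : 2 * ξ (b.l' 1 ![Y] γ X) = -ξ (curv cov' X Y γ) :=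
      dual_two_mul_l'_one hD.delta hconn (hD.higher 0) (hD.sq_zero 2) hgauge ξ X Y γ
    have hhalf : 2 * algebraMap ℝ (SmoothFun B M) (1 / 2) = 1 := by
      rw [← map_ofNat (algebraMap ℝ (SmoothFun B M)) 2, ← map_mul]
      norm_num
    have h := dual_mu_one hD.delta hconn (hD.higher 0) hD'.part hD'.commutator ξ X α β
    simp only [map_add, map_sub, map_neg, Sect.dual_smul_real]
    linear_combination h +
      algebraMap ℝ (SmoothFun B M) (1 / 2) * (hl' (b.ρ 0 ![] β) α - hl' (b.ρ 0 ![] α) β) -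
      (ξ (b.l' 1 ![b.ρ 0 ![] β] α X) - ξ (b.l' 1 ![b.ρ 0 ![] α] β X)) * hhalf
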